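/- **Theorem 3.** Consider Maxwell's equations in Gaussian units on $\mathbb{R}^3$, $$\nabla\times\mathbf B-\frac1c\frac{\partial\mathbf E}{\partial t}=\frac{4\pi}{c}\,\mathbf j,\qquad \nabla\cdot\mathbf E=4\pi\rho,\qquad \nabla\times\mathbf E+\frac1c\frac{\partial\mathbf B}{\partial t}=0,\qquad \nabla\cdot\mathbf B=0,$$ with $c>0$, and let $(\mathbf E,\mathbf B)$ be a solution, for times in an open set containing $t_0$, with locally square integrable fields. Charges and currents may be Radon measures (for instance surface charges), and the equations are understood in the sense of distributions in space (integrals of $\mathbf E$ and $\mathbf B$ against test fields are differentiable in $t$). Decay at infinity is needed only through finiteness of the total energy $$\mathcal E=\frac1{8\pi}\int_{\mathbb R^3}\left(|\mathbf E|^2+|\mathbf B|^2\right)\in[0,\infty]$$ at time $t_0$; if $\mathcal E=\infty$ the inequalities below are trivial. Let $U\subset\mathbb R^3$ be a bounded measurable region with more than one point, let $\mathcal R>0$ and $x_0$ be the radius and the centre of the smallest closed ball that encloses $U$, and assume that $\rho(\cdot,t_0)$ has compact support contained in $U$. Put, at time $t_0$, $$Q=\int_U\rho,\qquad J(U)=\frac1{4\pi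 c}\int_U (\mathbf x-x_0)\times(\mathbf E\times\mathbf B).$$ Then, at time $t_0$, $$\frac{c|J(U)|}{\mathcal R}+\frac{Q^2}{2\mathcal R}\le\mathcal E,$$ and in particular $$\frac{Q^4}{4\mathcal R^2}+\frac{c^2|J(U)|^2}{\mathcal R^2}\le\mathcal E^2 .$$ Moreover, if equality holds in the first inequality, then at time $t_0$ the electromagnetic field is (almost everywhere) that of an electrostatic spherical thin shell with centre $x_0$, radius $\mathcal R$, constant surface charge density and total charge $Q$: $\mathbf E=-\nabla\Phi_0$, where $\Phi_0(x)=Q/\max(|x-x_0|,\mathcal R)$, and $\mathbf B=0$; hence also $J(U)=0$. -/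

import Mathlib

open scoped ContDiff ENNReal

/-- Euclidean three-dimensional space. -/
abbrev E3 : Type := EuclideanSpace ℝ (Fin 3)

/-- The vector product of `ℝ³`. -/
def cross3 (u v : E3) : E3 := WithLp.toLp 2 (crossProduct u.ofLp v.ofLp)

/-- The partial derivative `∂ᵢ φⱼ` at `x`. -/
noncomputable def partialD (φ : E3 → E3) (i j : Fin 3) (x : E3) : ℝ :=
  (fderiv ℝ φ x (EuclideanSpace.single i 1)) j

/-- The curl of a differentiable vector field. -/
noncomputable def curl3 (φ : E3 → E3) (x : E3) : E3 :=
  !₂[partialD φ 1 2 x - partialD φ 2 1 x,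
     partialD φ 2 0 x - partialD φ 0 2 x,
     partialD φ 0 1 x - partialD φ 1 0 x]

/-- Smooth compactly supported test functions and test vector fields on `ℝ³`. -/
def IsTest {F : Type*} [NormedAddCommGroup F] [NormedSpace ℝ F] (φ : E3 → F) : Prop :=
  ContDiff ℝ ∞ φ ∧ HasCompactSupport φ

/-- Square integrability on every compact set: the field has finite energy in bounded regions. -/
def LocallySquareIntegrable (F : E3 → E3) : Prop :=
  ∀ K : Set E3, IsCompact K →
    MeasureTheory.MemLp F 2 ((MeasureTheory.volume : MeasureTheory.Measure E3).restrict K)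

/-- `(E, B)` is a solution, for times in `I` and on all of space, of Maxwell's equations in
Gaussian units
`curl B - (1/c) ∂E/∂t = (4π/c) j`, `div E = 4πρ`, `curl E + (1/c) ∂B/∂t = 0`, `div B = 0`,
in the sense of distributions in space.

The sources at time `t` are the charge `ρ t · μ t` and the current `j t · μ t`, where `μ t` is a
locally finite measure and `ρ t`, `j t` are locally integrable densities with respect to it.
For volume charges `μ t` is Lebesgue measure, for surface charges it is surface measure; in this
way all charges and currents that are (signed, vector) Radon measures are covered. -/
structure IsMaxwellSolution (c : ℝ) (I : Set ℝ) (μ : ℝ → MeasureTheory.Measure E3)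
    (ρ : ℝ → E3 → ℝ) (j E B : ℝ → E3 → E3) : Prop where
  locallyFinite : ∀ t ∈ I, MeasureTheory.IsLocallyFiniteMeasure (μ t)
  charge_locallyIntegrable : ∀ t ∈ I, MeasureTheory.LocallyIntegrable (ρ t) (μ t)
  current_locallyIntegrable : ∀ t ∈ I, MeasureTheory.LocallyIntegrable (j t) (μ t)
  electric_locallySquareIntegrable : ∀ t ∈ I, LocallySquareIntegrable (E t)
  magnetic_locallySquareIntegrable : ∀ t ∈ I, LocallySquareIntegrable (B t)
  /-- `div E = 4πρ` -/
  gauss_electric : ∀ t ∈ I, ∀ φ : E3 → ℝ, IsTest φ →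
    -∫ x, inner ℝ (E t x) (gradient φ x) = 4 * Real.pi * ∫ x, φ x * ρ t x ∂(μ t)
  /-- `div B = 0` -/
  gauss_magnetic : ∀ t ∈ I, ∀ φ : E3 → ℝ, IsTest φ →
    -∫ x, inner ℝ (B t x) (gradient φ x) = 0
  /-- `∂E/∂t = c curl B - 4πj` -/
  ampere : ∀ t ∈ I, ∀ φ : E3 → E3, IsTest φ →
    HasDerivAt (fun s => ∫ x, inner ℝ (E s x) (φ x))
      (c * (∫ x, inner ℝ (B t x) (curl3 φ x))
        - 4 * Real.pi * ∫ x, inner ℝ (j t x) (φ x) ∂(μ t)) t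
  /-- `∂B/∂t = - c curl E` -/
  faraday : ∀ t ∈ I, ∀ φ : E3 → E3, IsTest φ →
    HasDerivAt (fun s => ∫ x, inner ℝ (B s x) (φ x))
      (-(c * ∫ x, inner ℝ (E t x) (curl3 φ x))) t

/-- The charge `ρ · μ` has compact support contained in `U`. -/
def HasCompactSupportIn (μ : MeasureTheory.Measure E3) (ρ : E3 → ℝ) (U : Set E3) : Prop :=
  ∃ K : Set E3, IsCompact K ∧ K ⊆ U ∧ ∀ᵐ x ∂μ, x ∉ K → ρ x = 0

/-- The electric charge `Q(U)` contained in `U`. -/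
noncomputable def charge (μ : MeasureTheory.Measure E3) (ρ : E3 → ℝ) (U : Set E3) : ℝ :=
  ∫ x in U, ρ x ∂μ

/-- The total energy `(1/8π) ∫ |E|² + |B|²` over the whole space, a number in `[0, ∞]`. -/
noncomputable def totalEnergy (E B : E3 → E3) : ℝ≥0∞ :=
  ENNReal.ofReal (1 / (8 * Real.pi)) * ∫⁻ x, (‖E x‖ₑ ^ 2 + ‖B x‖ₑ ^ 2)

/-- The angular momentum vector of the electromagnetic field in `U` with respect to `x₀`. -/
noncomputable def angularMomentum (c : ℝ) (x₀ : E3) (E B : E3 → E3) (U : Set E3) : E3 :=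
  (1 / (4 * Real.pi * c)) • ∫ x in U, cross3 (x - x₀) (cross3 (E x) (B x))

/-- The closed ball with centre `x₀` and radius `R` is the smallest ball that encloses `U`. -/
def IsSmallestEnclosingBall (U : Set E3) (x₀ : E3) (R : ℝ) : Prop :=
  U ⊆ Metric.closedBall x₀ R ∧ ∀ (y : E3) (r : ℝ), U ⊆ Metric.closedBall y r → R ≤ r

/-- The electrostatic potential of a spherical thin shell with centre `x₀`, radius `R`, constant
surface charge density and total charge `Q`: it is `Q / r` for `r ≥ R` and `Q / R` for `r ≤ R`,
where `r` is the distance to `x₀`. -/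
noncomputable def shellPotential (x₀ : E3) (R Q : ℝ) (x : E3) : ℝ :=
  Q / max (dist x x₀) R

/-- The electric field `-∇Φ` of the shell (the sphere itself, where the field jumps, is a
null set). -/
noncomputable def shellField (x₀ : E3) (R Q : ℝ) (x : E3) : E3 :=
  -gradient (shellPotential x₀ R Q) x

/-!
Angular momentum is paid for by the energy inside the enclosing ball, and charge by the energy
outside it, so the two costs add up.

Inside, the density of angular momentum satisfies
`|(x - x₀) × (E × B)| ≤ |x - x₀| |E| |B| ≤ |x - x₀| (|E|² + |B|²) / 2`, and `|x - x₀| ≤ R` on `U`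
(`norm_angularMomentum_le`). Outside, let `H = (x - x₀) / |x - x₀|³`, extended by `0` to the ball,
be the field of the unit shell. Gauss's law, tested with the potential of this shell, which equals
`1 / R` on the charge, gives `∫ E · H = 4πQ / R` (`integral_inner_unitShellField`). As the shell
potential is neither smooth nor compactly supported, this is obtained as a limit of smooth cutoffs,
with dominated convergence since `E` and `H` are square integrable. Together with
`∫ |H|² = 4π / R` (`unitShellField_energy`), expanding `|E - Q H|² ≥ 0` shows that the electric
energy outside the ball is at least `Q² / (2R)`.

All losses are collected in one nonnegative function, `deficitDensity`, equal to
`(1 - |x - x₀| / R) (|E|² + |B|²)` in the ball and to `|E - Q H|² + |B|²` outside. Its integral is at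
most `8π` times the difference of the two sides of the inequality. In the case of equality it
vanishes almost everywhere, and because the factor `1 - |x - x₀| / R` is positive in the open ball,
this says `E = Q H` and `B = 0` almost everywhere.
-/

open MeasureTheory Filter Topology Set

/-! ### Radial functions and the shell field -/

/-- The chain rule for radial functions, written in terms of the squared distance, which is smooth
also at the centre. -/
lemma hasGradientAt_comp_norm_sub_sq {f : ℝ → ℝ} {f' : ℝ} {x₀ x : E3}
    (hf : HasDerivAt f f' (‖x - x₀‖ ^ 2)) :
    HasGradientAt (fun y => f (‖y - x₀‖ ^ 2)) ((2 * f') • (x - x₀)) x := by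
  rw [hasGradientAt_iff_hasFDerivAt]
  have h1 : HasFDerivAt (fun y : E3 => ‖y - x₀‖ ^ 2) (2 • (innerSL ℝ (x - x₀))) x := by
    simpa using ((hasFDerivAt_id x).sub_const x₀).norm_sq
  have h2 := hf.comp_hasFDerivAt x h1
  refine h2.congr_fderiv ?_
  ext v
  simp
  ring

/-- The field `(x - x₀) / |x - x₀|³` outside the closed ball of radius `R`, and `0` inside: the
electric field of a uniformly charged sphere of unit total charge. -/
noncomputable def unitShellField (x₀ : E3) (R : ℝ) (x : E3) : E3 :=
  if R < ‖x - x₀‖ then (‖x - x₀‖ ^ 3)⁻¹ • (x - x₀) else 0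

lemma rpow_sq_neg_three_halves {r : ℝ} (hr : 0 ≤ r) : (r ^ 2) ^ (-3 / 2 : ℝ) = (r ^ 3)⁻¹ := by
  rw [← Real.rpow_natCast r 2, ← Real.rpow_mul hr, ← Real.rpow_natCast r 3, ← Real.rpow_neg hr]
  norm_num

lemma norm_sq_unitShellField {x₀ : E3} {R : ℝ} (hR : 0 < R) (x : E3) :
    ‖unitShellField x₀ R x‖ ^ 2 = if R < ‖x - x₀‖ then (‖x - x₀‖ ^ 4)⁻¹ else 0 := by
  unfold unitShellField
  split_ifs with h
  · have : 0 < ‖x - x₀‖ := hR.trans h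
    rw [norm_smul, norm_inv, norm_pow, norm_norm]
    field_simp
  · simp

lemma measurable_unitShellField (x₀ : E3) (R : ℝ) : Measurable (unitShellField x₀ R) := by
  unfold unitShellField
  refine Measurable.ite (measurableSet_lt measurable_const (by fun_prop)) ?_ measurable_const
  fun_prop

/-- In polar coordinates the energy integral of the unit shell field is
`4π ∫_R^∞ r² r⁻⁴ dr = 4π / R`. -/
lemma unitShellField_energy (x₀ : E3) {R : ℝ} (hR : 0 < R) :
    Integrable (fun x => ‖unitShellField x₀ R x‖ ^ 2) ∧
      ∫ x, ‖unitShellField x₀ R x‖ ^ 2 = 4 * Real.pi / R := by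
  let g : ℝ → ℝ := fun r => if R < r then (r ^ 4)⁻¹ else 0
  have hfg : (fun x => ‖unitShellField x₀ R x‖ ^ 2) = fun x => g ‖x - x₀‖ := by
    ext x; exact norm_sq_unitShellField hR x
  have hdim : Module.finrank ℝ E3 = 3 := by simp
  -- the radial weight cancels to `r⁻²` on `(R, ∞)`
  have hrad : (fun y : ℝ => y ^ (Module.finrank ℝ E3 - 1) • g y) =
      (Ioi R).indicator fun y => y ^ (-2 : ℝ) := by
    ext y
    rw [hdim]
    by_cases hy : R < y
    · have hy0 : 0 < y := hR.trans hy
      have : y ^ (-2 : ℝ) = (y ^ 2)⁻¹ := by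
        rw [Real.rpow_neg hy0.le]; norm_num
      simp only [g, hy, if_true, indicator_of_mem (mem_Ioi.2 hy), this, smul_eq_mul]
      field_simp
    · simp [g, hy]
  have hsub : Ioi R ∩ Ioi (0 : ℝ) = Ioi R := inter_eq_left.2 (Ioi_subset_Ioi hR.le)
  have hsub' : Ioi (0 : ℝ) ∩ Ioi R = Ioi R := by rw [inter_comm, hsub]
  rw [hfg]
  constructor
  · refine Integrable.comp_sub_right (f := fun x : E3 => g ‖x‖) ?_ x₀
    rw [integrable_fun_norm_addHaar (volume : Measure E3) (f := g), hrad,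
      integrableOn_indicator_iff measurableSet_Ioi, hsub]
    exact integrableOn_Ioi_rpow_of_lt (by norm_num) hR
  · rw [integral_sub_right_eq_self (fun x : E3 => g ‖x‖) x₀,
      integral_fun_norm_addHaar (volume : Measure E3) g, hrad,
      setIntegral_indicator measurableSet_Ioi, hsub',
      integral_Ioi_rpow_of_lt (by norm_num) hR, hdim, Measure.real,
      EuclideanSpace.volume_ball_fin_three]
    have hpi : (ENNReal.ofReal (Real.pi * 4 / 3)).toReal = Real.pi * 4 / 3 :=
      ENNReal.toReal_ofReal (by positivity)
    norm_num [Real.rpow_neg_one, hpi]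
    field_simp

lemma memLp_unitShellField (x₀ : E3) {R : ℝ} (hR : 0 < R) :
    MemLp (unitShellField x₀ R) 2 :=
  (memLp_two_iff_integrable_sq_norm
    (measurable_unitShellField x₀ R).aestronglyMeasurable).2 (unitShellField_energy x₀ hR).1

/-- Off the sphere, where its potential is not differentiable, the shell field is the multiple
`Q` of the unit shell field. -/
lemma shellField_eq_smul_unitShellField {x₀ : E3} {R : ℝ} (hR : 0 < R) (Q : ℝ) {x : E3}
    (hx : ‖x - x₀‖ ≠ R) : shellField x₀ R Q x = Q • unitShellField x₀ R x := by
  have hcont : Continuous fun y : E3 => ‖y - x₀‖ := by fun_prop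
  unfold shellField unitShellField
  rcases lt_or_gt_of_ne hx with h | h
  · have hev : shellPotential x₀ R Q =ᶠ[𝓝 x] fun _ => Q / R := by
      filter_upwards [hcont.continuousAt.eventually_lt continuousAt_const h] with y hy
      rw [shellPotential, dist_eq_norm, max_eq_right hy.le]
    rw [((hasGradientAt_const x (Q / R)).congr_of_eventuallyEq hev).gradient]
    simp [h.not_gt]
  · have h0 : 0 < ‖x - x₀‖ := hR.trans h
    have hev : shellPotential x₀ R Q =ᶠ[𝓝 x]
        fun y => Q * (‖y - x₀‖ ^ 2) ^ (-1 / 2 : ℝ) := by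
      filter_upwards [continuousAt_const.eventually_lt hcont.continuousAt h] with y hy
      rw [shellPotential, dist_eq_norm, max_eq_left hy.le, ← Real.rpow_natCast,
        ← Real.rpow_mul (norm_nonneg _), div_eq_mul_inv, ← Real.rpow_neg_one]
      norm_num
    have hd : HasDerivAt (fun s : ℝ => Q * s ^ (-1 / 2 : ℝ))
        (Q * ((-1 / 2) * (‖x - x₀‖ ^ 2) ^ (-1 / 2 - 1 : ℝ))) (‖x - x₀‖ ^ 2) :=
      (Real.hasDerivAt_rpow_const (Or.inl (by positivity))).const_mul Q
    rw [((hasGradientAt_comp_norm_sub_sq hd).congr_of_eventuallyEq hev).gradient, if_pos h,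
      show (-1 / 2 - 1 : ℝ) = -3 / 2 by norm_num, rpow_sq_neg_three_halves h0.le, smul_smul,
      ← neg_smul]
    congr 1
    ring

lemma ae_norm_sub_ne (x₀ : E3) {R : ℝ} (hR : 0 < R) : ∀ᵐ x : E3, ‖x - x₀‖ ≠ R := by
  have hs : ∀ᵐ x : E3, x ∉ Metric.sphere x₀ R :=
    measure_eq_zero_iff_ae_notMem.1 (Measure.addHaar_sphere_of_ne_zero volume x₀ hR.ne')
  filter_upwards [hs] with x hx h
  exact hx (by simpa [dist_eq_norm] using h)

lemma shellField_ae_eq (x₀ : E3) {R : ℝ} (hR : 0 < R) (Q : ℝ) :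
    shellField x₀ R Q =ᵐ[volume] fun x => Q • unitShellField x₀ R x := by
  filter_upwards [ae_norm_sub_ne x₀ hR] with x hx
  exact shellField_eq_smul_unitShellField hR Q hx

/-! ### The flux of the electric field through spheres around the charge -/

/-- Gauss's law tested with the radial function `x ↦ ∫_{|x - x₀|²}^b k`: it is constant on the
ball that contains the charge, so that only the total charge enters. -/
lemma integral_inner_radial_eq_charge {μ : Measure E3} {ρ : E3 → ℝ} {E : E3 → E3}
    (hgauss : ∀ φ : E3 → ℝ, IsTest φ →
      -∫ x, inner ℝ (E x) (gradient φ x) = 4 * Real.pi * ∫ x, φ x * ρ x ∂μ)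
    {U : Set E3} {x₀ : E3} {R : ℝ} (hU : U ⊆ Metric.closedBall x₀ R)
    (hsupp : HasCompactSupportIn μ ρ U) {k : ℝ → ℝ} {b : ℝ} (hk : ContDiff ℝ ∞ k)
    (hkR : ∀ u ≤ R ^ 2, k u = 0) (hkb : ∀ u, b ≤ u → k u = 0) :
    ∫ x, inner ℝ (E x) ((2 * k (‖x - x₀‖ ^ 2)) • (x - x₀)) =
      4 * Real.pi * (charge μ ρ U * ∫ u in (R ^ 2)..b, k u) := by
  set f : ℝ → ℝ := fun s => -∫ u in b..s, k u with hf
  have hfd : ∀ s, HasDerivAt f (-k s) s := fun s =>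
    (hk.continuous.integral_hasStrictDerivAt b s).hasDerivAt.neg
  have hfc : ContDiff ℝ ∞ f := by
    rw [contDiff_infty_iff_deriv, funext fun s => (hfd s).deriv]
    exact ⟨fun s => (hfd s).differentiableAt, hk.neg⟩
  have hfR : ∀ s ≤ R ^ 2, f s = ∫ u in (R ^ 2)..b, k u := by
    intro s hs
    have h0 : ∫ u in s..(R ^ 2), k u = 0 := by
      rw [intervalIntegral.integral_congr (g := fun _ => 0)]
      · simp
      · intro u hu
        rw [uIcc_of_le hs] at hu
        exact hkR u hu.2
    have := intervalIntegral.integral_add_adjacent_intervals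
      (hk.continuous.intervalIntegrable (μ := volume) s (R ^ 2))
      (hk.continuous.intervalIntegrable (μ := volume) (R ^ 2) b)
    rw [h0, zero_add] at this
    rw [this, intervalIntegral.integral_symm]
  have hfb : ∀ s, b ≤ s → f s = 0 := by
    intro s hs
    have h0 : ∫ u in b..s, k u = 0 := by
      rw [intervalIntegral.integral_congr (g := fun _ => 0)]
      · simp
      · intro u hu
        rw [uIcc_of_le hs] at hu
        exact hkb u hu.1
    simp [hf, h0]
  have htest : IsTest fun x : E3 => f (‖x - x₀‖ ^ 2) := by
    refine ⟨hfc.comp ((contDiff_id.sub contDiff_const).norm_sq ℝ), ?_⟩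
    refine HasCompactSupport.intro (isCompact_closedBall x₀ (|b| + 1)) fun x hx => hfb _ ?_
    rw [Metric.mem_closedBall, dist_eq_norm, not_le] at hx
    nlinarith [le_abs_self b, abs_nonneg b]
  have hgrad : ∀ x, gradient (fun x : E3 => f (‖x - x₀‖ ^ 2)) x =
      -((2 * k (‖x - x₀‖ ^ 2)) • (x - x₀)) := fun x => by
    rw [(hasGradientAt_comp_norm_sub_sq (hfd _)).gradient, mul_neg, neg_smul]
  have hmain := hgauss _ htest
  simp only [hgrad, inner_neg_right, integral_neg, neg_neg] at hmain
  rw [hmain]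
  congr 1
  obtain ⟨K, -, hKU, hK⟩ := hsupp
  have hcharge : charge μ ρ U = ∫ x, ρ x ∂μ :=
    setIntegral_eq_integral_of_ae_compl_eq_zero <| by
      filter_upwards [hK] with x hx hxU using hx fun h => hxU (hKU h)
  rw [hcharge, mul_comm, ← integral_const_mul]
  refine integral_congr_ae ?_
  filter_upwards [hK] with x hx
  by_cases hxK : x ∈ K
  · have hxR := hU (hKU hxK)
    rw [Metric.mem_closedBall, dist_eq_norm] at hxR
    rw [hfR _ (pow_le_pow_left₀ (norm_nonneg _) hxR 2)]
  · simp [hx hxK]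

/-- A smooth cutoff of the half-line `(a, ∞)`: it takes values in `[0, 1]`, vanishes near
`(-∞, a]` and on `[a + n + 2, ∞)`, and tends to `1` at each point of `(a, ∞)` as `n → ∞`. -/
noncomputable def halfLineCutoff (a : ℝ) (n : ℕ) (u : ℝ) : ℝ :=
  Real.smoothTransition ((n + 1) * (u - a) - 1) * Real.smoothTransition (a + n + 2 - u)

lemma contDiff_halfLineCutoff (a : ℝ) (n : ℕ) : ContDiff ℝ ∞ (halfLineCutoff a n) := by
  unfold halfLineCutoff
  exact (Real.smoothTransition.contDiff.comp (by fun_prop)).mul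
    (Real.smoothTransition.contDiff.comp (by fun_prop))

lemma halfLineCutoff_nonneg (a : ℝ) (n : ℕ) (u : ℝ) : 0 ≤ halfLineCutoff a n u :=
  mul_nonneg (Real.smoothTransition.nonneg _) (Real.smoothTransition.nonneg _)

lemma halfLineCutoff_le_one (a : ℝ) (n : ℕ) (u : ℝ) : halfLineCutoff a n u ≤ 1 :=
  mul_le_one₀ (Real.smoothTransition.le_one _) (Real.smoothTransition.nonneg _)
    (Real.smoothTransition.le_one _)

lemma halfLineCutoff_eq_zero_left {a : ℝ} {n : ℕ} {u : ℝ} (hu : u ≤ a + ((n : ℝ) + 1)⁻¹) :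
    halfLineCutoff a n u = 0 := by
  have hn : (0 : ℝ) < n + 1 := by positivity
  have : ((n : ℝ) + 1) * (u - a) ≤ 1 := by
    calc ((n : ℝ) + 1) * (u - a) ≤ (n + 1) * ((n : ℝ) + 1)⁻¹ := by gcongr; linarith
      _ = 1 := mul_inv_cancel₀ hn.ne'
  rw [halfLineCutoff, Real.smoothTransition.zero_of_nonpos (by linarith), zero_mul]

lemma halfLineCutoff_eq_zero_right {a : ℝ} {n : ℕ} {u : ℝ} (hu : a + n + 2 ≤ u) :
    halfLineCutoff a n u = 0 := by
  rw [halfLineCutoff, Real.smoothTransition.zero_of_nonpos (x := a + n + 2 - u) (by linarith),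
    mul_zero]

lemma eventually_halfLineCutoff_eq_one {a u : ℝ} (hu : a < u) :
    ∀ᶠ n : ℕ in atTop, halfLineCutoff a n u = 1 := by
  have h0 : 0 < u - a := sub_pos.2 hu
  filter_upwards [tendsto_natCast_atTop_atTop.eventually_ge_atTop (2 / (u - a)),
    tendsto_natCast_atTop_atTop.eventually_ge_atTop (u - a)] with n h1 h2
  rw [div_le_iff₀ h0] at h1
  rw [halfLineCutoff, Real.smoothTransition.one_of_one_le (by linarith),
    Real.smoothTransition.one_of_one_le (by linarith), one_mul]

lemma tendsto_halfLineCutoff_mul (a u : ℝ) (y : ℝ) :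
    Tendsto (fun n => halfLineCutoff a n u * y) atTop
      (𝓝 ((Ioi a).indicator (fun _ => y) u)) := by
  by_cases hu : a < u
  · rw [indicator_of_mem (mem_Ioi.2 hu)]
    refine tendsto_const_nhds.congr' ?_
    filter_upwards [eventually_halfLineCutoff_eq_one hu] with n hn
    rw [hn, one_mul]
  · rw [indicator_of_notMem (notMem_Ioi.2 (not_lt.1 hu))]
    refine tendsto_const_nhds.congr fun n => ?_
    rw [halfLineCutoff_eq_zero_left, zero_mul]
    have : (0 : ℝ) ≤ ((n : ℝ) + 1)⁻¹ := by positivity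
    linarith

/-- The cutoff keeps away from the singularity of `u ↦ u ^ p` at the origin. -/
lemma contDiff_halfLineCutoff_mul_rpow {a : ℝ} (ha : 0 ≤ a) (n : ℕ) (p : ℝ) :
    ContDiff ℝ ∞ fun u => halfLineCutoff a n u * u ^ p := by
  rw [contDiff_iff_contDiffAt]
  intro u
  have hn : (0 : ℝ) < ((n : ℝ) + 1)⁻¹ := by positivity
  by_cases hu : u < a + ((n : ℝ) + 1)⁻¹
  · refine (contDiffAt_const (c := (0 : ℝ))).congr_of_eventuallyEq ?_
    filter_upwards [Iio_mem_nhds hu] with v hv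
    rw [halfLineCutoff_eq_zero_left (le_of_lt hv), zero_mul]
  · exact (contDiff_halfLineCutoff a n).contDiffAt.mul
      (contDiffAt_id.rpow_const_of_ne (by simp only [id]; linarith))

lemma integrable_inner_of_memLp_two {α : Type*} {m : MeasurableSpace α} {μ : Measure α}
    {F G : α → E3} (hF : MemLp F 2 μ) (hG : MemLp G 2 μ) :
    Integrable (fun x => inner ℝ (F x) (G x)) μ := by
  refine Integrable.mono' (hF.norm.integrable_mul hG.norm)
    (hF.aestronglyMeasurable.inner hG.aestronglyMeasurable) (ae_of_all _ fun x => ?_)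
  exact norm_inner_le_norm _ _

/-- Gauss's law tested with the potential `1 / max (|x - x₀|, R)` of the unit shell, which equals
`1 / R` on the charge. It is not itself a test function: it is the limit of the potentials whose
field is the shell field cut off near the sphere and at infinity. -/
lemma integral_inner_unitShellField {μ : Measure E3} {ρ : E3 → ℝ} {E : E3 → E3}
    (hgauss : ∀ φ : E3 → ℝ, IsTest φ →
      -∫ x, inner ℝ (E x) (gradient φ x) = 4 * Real.pi * ∫ x, φ x * ρ x ∂μ)
    {U : Set E3} {x₀ : E3} {R : ℝ} (hR : 0 < R) (hU : U ⊆ Metric.closedBall x₀ R)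
    (hsupp : HasCompactSupportIn μ ρ U) (hE : MemLp E 2) :
    ∫ x, inner ℝ (E x) (unitShellField x₀ R x) = 4 * Real.pi * charge μ ρ U / R := by
  set k : ℕ → ℝ → ℝ := fun n u => halfLineCutoff (R ^ 2) n u * u ^ (-3 / 2 : ℝ) with hk
  have hkc : ∀ n, ContDiff ℝ ∞ (k n) := fun n =>
    contDiff_halfLineCutoff_mul_rpow (by positivity) n _
  have hkR : ∀ n, ∀ u ≤ R ^ 2, k n u = 0 := fun n u hu => by
    have : (0 : ℝ) ≤ ((n : ℝ) + 1)⁻¹ := by positivity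
    simp only [hk, halfLineCutoff_eq_zero_left (show u ≤ R ^ 2 + ((n : ℝ) + 1)⁻¹ by linarith),
      zero_mul]
  have hkb : ∀ n : ℕ, ∀ u, R ^ 2 + n + 2 ≤ u → k n u = 0 := fun n u hu => by
    simp only [hk, halfLineCutoff_eq_zero_right hu, zero_mul]
  have hfield : ∀ n x, k n (‖x - x₀‖ ^ 2) • (x - x₀) =
      halfLineCutoff (R ^ 2) n (‖x - x₀‖ ^ 2) • unitShellField x₀ R x := by
    intro n x
    unfold unitShellField
    split_ifs with h
    · rw [smul_smul, ← rpow_sq_neg_three_halves (norm_nonneg _)]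
    · rw [hkR n _ (pow_le_pow_left₀ (norm_nonneg _) (not_lt.1 h) 2), zero_smul, smul_zero]
  have hflux : ∀ n, ∫ x, halfLineCutoff (R ^ 2) n (‖x - x₀‖ ^ 2) *
        inner ℝ (E x) (unitShellField x₀ R x) =
      4 * Real.pi * (charge μ ρ U * ((∫ u in Ioi (R ^ 2), k n u) / 2)) := by
    intro n
    have h := integral_inner_radial_eq_charge hgauss hU hsupp
      (k := fun u => k n u / 2) (b := R ^ 2 + n + 2) ((hkc n).div_const 2)
      (fun u hu => by simp [hkR n u hu]) (fun u hu => by simp [hkb n u hu])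
    simp only [mul_div_cancel₀ _ (two_ne_zero' ℝ), hfield, inner_smul_right] at h
    rw [h, intervalIntegral.integral_div, intervalIntegral.integral_of_le
      (by have : (0 : ℝ) ≤ n := by positivity
          linarith)]
    congr 3
    refine (setIntegral_eq_of_subset_of_forall_sdiff_eq_zero measurableSet_Ioi
      Ioc_subset_Ioi_self fun u hu => ?_).symm
    exact hkb n u (le_of_lt (not_le.1 fun hle => hu.2 ⟨hu.1, hle⟩))
  have hlim₁ : Tendsto (fun n => ∫ x, halfLineCutoff (R ^ 2) n (‖x - x₀‖ ^ 2) *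
        inner ℝ (E x) (unitShellField x₀ R x)) atTop
      (𝓝 (∫ x, inner ℝ (E x) (unitShellField x₀ R x))) := by
    have hint := integrable_inner_of_memLp_two hE (memLp_unitShellField x₀ hR)
    refine tendsto_integral_of_dominated_convergence _ (fun n => ?_) hint.norm
      (fun n => ae_of_all _ fun x => ?_) (ae_of_all _ fun x => ?_)
    · have hc : Continuous fun x : E3 => halfLineCutoff (R ^ 2) n (‖x - x₀‖ ^ 2) :=
        (contDiff_halfLineCutoff _ n).continuous.comp (by fun_prop)
      exact hc.aestronglyMeasurable.mul hint.aestronglyMeasurable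
    · rw [norm_mul, Real.norm_of_nonneg (halfLineCutoff_nonneg _ _ _)]
      exact mul_le_of_le_one_left (norm_nonneg _) (halfLineCutoff_le_one _ _ _)
    · convert tendsto_halfLineCutoff_mul (R ^ 2) (‖x - x₀‖ ^ 2) _ using 2
      by_cases h : R < ‖x - x₀‖
      · rw [indicator_of_mem (mem_Ioi.2 (pow_lt_pow_left₀ h hR.le two_ne_zero))]
      · rw [indicator_of_notMem
          (notMem_Ioi.2 (pow_le_pow_left₀ (norm_nonneg _) (not_lt.1 h) 2)),
          unitShellField, if_neg h, inner_zero_right]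
  have hlim₂ : Tendsto (fun n => ∫ u in Ioi (R ^ 2), k n u) atTop
      (𝓝 (∫ u in Ioi (R ^ 2), u ^ (-3 / 2 : ℝ))) := by
    have hpos : ∀ u ∈ Ioi (R ^ 2), 0 ≤ u ^ (-3 / 2 : ℝ) := fun u hu =>
      Real.rpow_nonneg ((sq_nonneg R).trans (le_of_lt hu)) _
    refine tendsto_integral_of_dominated_convergence (fun u => u ^ (-3 / 2 : ℝ))
      (fun n => (hkc n).continuous.aestronglyMeasurable)
      (integrableOn_Ioi_rpow_of_lt (by norm_num) (by positivity))
      (fun n => (ae_restrict_iff' measurableSet_Ioi).2 (ae_of_all _ fun u hu => ?_))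
      ((ae_restrict_iff' measurableSet_Ioi).2 (ae_of_all _ fun u hu => ?_))
    · rw [norm_mul, Real.norm_of_nonneg (halfLineCutoff_nonneg _ _ _),
        Real.norm_of_nonneg (hpos u hu)]
      exact mul_le_of_le_one_left (hpos u hu) (halfLineCutoff_le_one _ _ _)
    · have h := tendsto_halfLineCutoff_mul (R ^ 2) u (u ^ (-3 / 2 : ℝ))
      rwa [indicator_of_mem hu] at h
  have hval : ∫ u in Ioi (R ^ 2), u ^ (-3 / 2 : ℝ) = 2 / R := by
    rw [integral_Ioi_rpow_of_lt (by norm_num) (by positivity), ← Real.rpow_natCast R 2,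
      ← Real.rpow_mul hR.le, show ((2 : ℕ) : ℝ) * (-3 / 2 + 1) = -1 by norm_num,
      Real.rpow_neg_one]
    field_simp
    norm_num
  rw [hval] at hlim₂
  refine tendsto_nhds_unique hlim₁ ?_
  simp_rw [hflux]
  convert ((hlim₂.div_const 2).const_mul (charge μ ρ U)).const_mul (4 * Real.pi) using 2
  field_simp

/-! ### Energy and angular momentum -/

lemma LocallySquareIntegrable.aestronglyMeasurable {F : E3 → E3} (hF : LocallySquareIntegrable F) :
    AEStronglyMeasurable F volume := by
  rw [← Measure.restrict_univ (μ := (volume : Measure E3)),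
    ← Metric.iUnion_closedBall_nat (0 : E3), aestronglyMeasurable_iUnion_iff]
  exact fun n => (hF _ (isCompact_closedBall 0 n)).aestronglyMeasurable

lemma memLp_two_of_lintegral_enorm_sq_ne_top {F : E3 → E3} (hF : AEStronglyMeasurable F volume)
    (h : ∫⁻ x, ‖F x‖ₑ ^ 2 ≠ ⊤) : MemLp F 2 := by
  rw [memLp_two_iff_integrable_sq_norm hF]
  refine ⟨hF.norm.pow 2, ?_⟩
  simpa [HasFiniteIntegral, lt_top_iff_ne_top] using h

/-- Fields of finite total energy are square integrable. -/
lemma memLp_two_of_totalEnergy_ne_top {E B : E3 → E3} (hE : AEStronglyMeasurable E volume)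
    (hB : AEStronglyMeasurable B volume) (h : totalEnergy E B ≠ ⊤) : MemLp E 2 ∧ MemLp B 2 := by
  have hpos : ENNReal.ofReal (1 / (8 * Real.pi)) ≠ 0 := by
    rw [Ne, ENNReal.ofReal_eq_zero, not_le]; positivity
  have hfin : ∫⁻ x, (‖E x‖ₑ ^ 2 + ‖B x‖ₑ ^ 2) ≠ ⊤ := fun htop =>
    h (by rw [totalEnergy, htop, ENNReal.mul_top hpos])
  exact ⟨memLp_two_of_lintegral_enorm_sq_ne_top hE
      (ne_top_of_le_ne_top hfin (lintegral_mono fun x => le_self_add)),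
    memLp_two_of_lintegral_enorm_sq_ne_top hB
      (ne_top_of_le_ne_top hfin (lintegral_mono fun x => le_add_self))⟩

/-- The integrand of `8π` times the energy. -/
noncomputable def fieldDensity (E B : E3 → E3) (x : E3) : ℝ := ‖E x‖ ^ 2 + ‖B x‖ ^ 2

lemma fieldDensity_nonneg (E B : E3 → E3) (x : E3) : 0 ≤ fieldDensity E B x := by
  unfold fieldDensity; positivity

lemma integrable_fieldDensity {E B : E3 → E3} (hE : MemLp E 2) (hB : MemLp B 2) :
    Integrable (fieldDensity E B) :=
  ((memLp_two_iff_integrable_sq_norm hE.1).1 hE).add ((memLp_two_iff_integrable_sq_norm hB.1).1 hB)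

lemma totalEnergy_eq_ofReal {E B : E3 → E3} (hE : MemLp E 2) (hB : MemLp B 2) :
    totalEnergy E B = ENNReal.ofReal (1 / (8 * Real.pi) * ∫ x, fieldDensity E B x) := by
  rw [totalEnergy, ENNReal.ofReal_mul (by positivity),
    ofReal_integral_eq_lintegral_ofReal (integrable_fieldDensity hE hB)
      (ae_of_all _ (fieldDensity_nonneg E B))]
  congr 1
  refine lintegral_congr fun x => ?_
  rw [fieldDensity, ENNReal.ofReal_add (by positivity) (by positivity),
    ENNReal.ofReal_pow (norm_nonneg _), ENNReal.ofReal_pow (norm_nonneg _), ofReal_norm,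
    ofReal_norm]

lemma norm_cross3_le (u v : E3) : ‖cross3 u v‖ ≤ ‖u‖ * ‖v‖ := by
  rw [cross3, InnerProductGeometry.norm_ofLp_crossProduct]
  exact mul_le_of_le_one_right (by positivity) (Real.sin_le_one _)

/-- The energy density inside the ball, weighted with the lever arm `|x - x₀| / R ≤ 1`. It
dominates the angular momentum density. -/
noncomputable def leverDensity (E B : E3 → E3) (x₀ : E3) (R : ℝ) : E3 → ℝ :=
  (Metric.closedBall x₀ R).indicator fun x => ‖x - x₀‖ / R * fieldDensity E B x

lemma leverDensity_nonneg {E B : E3 → E3} {x₀ : E3} {R : ℝ} (hR : 0 < R) (x : E3) :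
    0 ≤ leverDensity E B x₀ R x :=
  indicator_nonneg (fun x _ => mul_nonneg (by positivity) (fieldDensity_nonneg E B x)) x

lemma integrable_leverDensity {E B : E3 → E3} {x₀ : E3} {R : ℝ} (hR : 0 < R) (hE : MemLp E 2)
    (hB : MemLp B 2) : Integrable (leverDensity E B x₀ R) := by
  have hint := integrable_fieldDensity hE hB
  have hc : Continuous fun x : E3 => ‖x - x₀‖ / R := by fun_prop
  refine Integrable.mono' hint
    ((hc.aestronglyMeasurable.mul hint.1).indicator measurableSet_closedBall)
    (ae_of_all _ fun x => ?_)
  rw [Real.norm_of_nonneg (leverDensity_nonneg hR x)]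
  refine indicator_apply_le' (fun hx => ?_) (fun _ => fieldDensity_nonneg E B x)
  rw [Metric.mem_closedBall, dist_eq_norm] at hx
  exact mul_le_of_le_one_left (fieldDensity_nonneg E B x) ((div_le_one hR).2 hx)

lemma norm_angularMomentum_le {c : ℝ} (hc : 0 < c) {E B : E3 → E3} {U : Set E3}
    (hUm : MeasurableSet U) {x₀ : E3} {R : ℝ} (hR : 0 < R) (hU : U ⊆ Metric.closedBall x₀ R)
    (hE : MemLp E 2) (hB : MemLp B 2) :
    8 * Real.pi * (c * ‖angularMomentum c x₀ E B U‖ / R) ≤ ∫ x, leverDensity E B x₀ R x := by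
  have hint := integrable_leverDensity (x₀ := x₀) hR hE hB
  have hle : ‖∫ x in U, cross3 (x - x₀) (cross3 (E x) (B x))‖ ≤
      ∫ x in U, R / 2 * leverDensity E B x₀ R x := by
    refine norm_integral_le_of_norm_le (hint.const_mul _).integrableOn
      ((ae_restrict_iff' hUm).2 (ae_of_all _ fun x hx => ?_))
    rw [leverDensity, indicator_of_mem (hU hx), fieldDensity]
    calc ‖cross3 (x - x₀) (cross3 (E x) (B x))‖ ≤ ‖x - x₀‖ * (‖E x‖ * ‖B x‖) :=
          (norm_cross3_le _ _).trans (by gcongr; exact norm_cross3_le _ _)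
      _ ≤ ‖x - x₀‖ * ((‖E x‖ ^ 2 + ‖B x‖ ^ 2) / 2) := by
          gcongr
          linarith [two_mul_le_add_sq ‖E x‖ ‖B x‖]
      _ = R / 2 * (‖x - x₀‖ / R * (‖E x‖ ^ 2 + ‖B x‖ ^ 2)) := by field_simp
  have hle' : ∫ x in U, R / 2 * leverDensity E B x₀ R x ≤
      R / 2 * ∫ x, leverDensity E B x₀ R x := by
    rw [integral_const_mul]
    refine mul_le_mul_of_nonneg_left ?_ (by positivity)
    exact setIntegral_le_integral hint (ae_of_all _ (leverDensity_nonneg hR))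
  have hpi := Real.pi_pos
  rw [angularMomentum, norm_smul, Real.norm_of_nonneg (by positivity)]
  calc 8 * Real.pi * (c * (1 / (4 * Real.pi * c) *
        ‖∫ x in U, cross3 (x - x₀) (cross3 (E x) (B x))‖) / R)
      = 2 / R * ‖∫ x in U, cross3 (x - x₀) (cross3 (E x) (B x))‖ := by field_simp; ring
    _ ≤ 2 / R * (R / 2 * ∫ x, leverDensity E B x₀ R x) := by
        gcongr
        exact hle.trans hle'
    _ = ∫ x, leverDensity E B x₀ R x := by field_simp

/-! ### The energy deficit -/

/-- A density whose integral is at most `8π` times the difference of the two sides of the energy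
inequality: it is `(1 - |x - x₀| / R) (|E|² + |B|²)` in the ball and `|E - Q H|² + |B|²` outside,
where `H` is the unit shell field. -/
noncomputable def deficitDensity (E B : E3 → E3) (x₀ : E3) (R Q : ℝ) (x : E3) : ℝ :=
  fieldDensity E B x - leverDensity E B x₀ R x
    - 2 * Q * inner ℝ (E x) (unitShellField x₀ R x) + Q ^ 2 * ‖unitShellField x₀ R x‖ ^ 2

lemma deficitDensity_of_le {E B : E3 → E3} {x₀ : E3} {R Q : ℝ} {x : E3} (hx : ‖x - x₀‖ ≤ R) :
    deficitDensity E B x₀ R Q x = (1 - ‖x - x₀‖ / R) * fieldDensity E B x := by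
  have hmem : x ∈ Metric.closedBall x₀ R := by rwa [Metric.mem_closedBall, dist_eq_norm]
  rw [deficitDensity, leverDensity, indicator_of_mem hmem, unitShellField, if_neg hx.not_gt,
    inner_zero_right, norm_zero]
  ring

lemma deficitDensity_of_gt {E B : E3 → E3} {x₀ : E3} {R Q : ℝ} {x : E3} (hx : R < ‖x - x₀‖) :
    deficitDensity E B x₀ R Q x = ‖E x - Q • unitShellField x₀ R x‖ ^ 2 + ‖B x‖ ^ 2 := by
  have hmem : x ∉ Metric.closedBall x₀ R := by
    rw [Metric.mem_closedBall, dist_eq_norm]; exact hx.not_ge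
  rw [deficitDensity, leverDensity, indicator_of_notMem hmem, fieldDensity, norm_sub_sq_real,
    inner_smul_right, norm_smul, mul_pow, Real.norm_eq_abs, sq_abs]
  ring

lemma deficitDensity_nonneg {E B : E3 → E3} {x₀ : E3} {R Q : ℝ} (hR : 0 < R) (x : E3) :
    0 ≤ deficitDensity E B x₀ R Q x := by
  rcases le_or_gt ‖x - x₀‖ R with hx | hx
  · rw [deficitDensity_of_le hx]
    exact mul_nonneg (sub_nonneg.2 ((div_le_one hR).2 hx)) (fieldDensity_nonneg E B x)
  · rw [deficitDensity_of_gt hx]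
    positivity

lemma eq_shell_of_deficitDensity_eq_zero {E B : E3 → E3} {x₀ : E3} {R Q : ℝ} (hR : 0 < R)
    {x : E3} (hx : ‖x - x₀‖ ≠ R) (h : deficitDensity E B x₀ R Q x = 0) :
    E x = Q • unitShellField x₀ R x ∧ B x = 0 := by
  rcases lt_or_gt_of_ne hx with hlt | hgt
  · rw [deficitDensity_of_le hlt.le] at h
    have h1 : 1 - ‖x - x₀‖ / R ≠ 0 := (sub_pos.2 ((div_lt_one hR).2 hlt)).ne'
    have h2 := (mul_eq_zero.1 h).resolve_left h1
    rw [fieldDensity, add_eq_zero_iff_of_nonneg (by positivity) (by positivity)] at h2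
    rw [unitShellField, if_neg hlt.not_gt, smul_zero]
    simpa using h2
  · rw [deficitDensity_of_gt hgt, add_eq_zero_iff_of_nonneg (by positivity) (by positivity)] at h
    simpa [sub_eq_zero] using h

lemma integral_deficitDensity {E B : E3 → E3} {x₀ : E3} {R Q : ℝ} (hR : 0 < R)
    (hE : MemLp E 2) (hB : MemLp B 2)
    (hflux : ∫ x, inner ℝ (E x) (unitShellField x₀ R x) = 4 * Real.pi * Q / R) :
    Integrable (deficitDensity E B x₀ R Q) ∧
      ∫ x, deficitDensity E B x₀ R Q x =
        (∫ x, fieldDensity E B x) - (∫ x, leverDensity E B x₀ R x) - 4 * Real.pi * Q ^ 2 / R := by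
  have h1 := integrable_fieldDensity hE hB
  have h2 := integrable_leverDensity (x₀ := x₀) hR hE hB
  have h3 := (integrable_inner_of_memLp_two hE (memLp_unitShellField x₀ hR)).const_mul (2 * Q)
  have h4 := (unitShellField_energy x₀ hR).1.const_mul (Q ^ 2)
  have h12 : Integrable fun x => fieldDensity E B x - leverDensity E B x₀ R x := h1.sub h2
  refine ⟨(h12.sub h3).add h4, ?_⟩
  unfold deficitDensity
  rw [integral_add (by exact h12.sub h3) h4, integral_sub h12 h3, integral_sub h1 h2,
    integral_const_mul, integral_const_mul, hflux, (unitShellField_energy x₀ hR).2]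
  ring

lemma IsSmallestEnclosingBall.radius_pos {U : Set E3} {x₀ : E3} {R : ℝ}
    (h : IsSmallestEnclosingBall U x₀ R) (hU : U.Nontrivial) : 0 < R := by
  obtain ⟨x, hx, y, hy, hxy⟩ := hU
  have h1 := h.1 hx
  have h2 := h.1 hy
  rw [Metric.mem_closedBall] at h1 h2
  have := dist_pos.2 hxy
  linarith [dist_triangle_right x y x₀]

/-! ### The energy inequality and its equality case -/

theorem theorem3 (c : ℝ) (hc : 0 < c)
    (I : Set ℝ) (hI : IsOpen I) (t₀ : ℝ) (ht₀ : t₀ ∈ I)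
    (μ : ℝ → MeasureTheory.Measure E3) (ρ : ℝ → E3 → ℝ) (j E B : ℝ → E3 → E3)
    (hsol : IsMaxwellSolution c I μ ρ j E B)
    (U : Set E3) (hUmeas : MeasurableSet U) (hUnontriv : U.Nontrivial)
    (x₀ : E3) (R : ℝ) (hball : IsSmallestEnclosingBall U x₀ R)
    (hsupp : HasCompactSupportIn (μ t₀) (ρ t₀) U)
    (Q : ℝ) (hQ : Q = charge (μ t₀) (ρ t₀) U)
    (J : E3) (hJ : J = angularMomentum c x₀ (E t₀) (B t₀) U) :
    ENNReal.ofReal (c * ‖J‖ / R + Q ^ 2 / (2 * R)) ≤ totalEnergy (E t₀) (B t₀) ∧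
    ENNReal.ofReal (Q ^ 4 / (4 * R ^ 2) + c ^ 2 * ‖J‖ ^ 2 / R ^ 2)
      ≤ totalEnergy (E t₀) (B t₀) ^ 2 ∧
    (ENNReal.ofReal (c * ‖J‖ / R + Q ^ 2 / (2 * R)) = totalEnergy (E t₀) (B t₀) →
      E t₀ =ᵐ[MeasureTheory.volume] shellField x₀ R Q ∧
      B t₀ =ᵐ[MeasureTheory.volume] (fun _ => 0) ∧
      J = 0) := by
  have hR : 0 < R := hball.radius_pos hUnontriv
  rcases eq_or_ne (totalEnergy (E t₀) (B t₀)) ⊤ with htop | hfin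
  · rw [htop]
    exact ⟨le_top, by simp, fun h => absurd h ENNReal.ofReal_ne_top⟩
  obtain ⟨hE, hB⟩ := memLp_two_of_totalEnergy_ne_top
    (hsol.electric_locallySquareIntegrable t₀ ht₀).aestronglyMeasurable
    (hsol.magnetic_locallySquareIntegrable t₀ ht₀).aestronglyMeasurable hfin
  have hflux := integral_inner_unitShellField (hsol.gauss_electric t₀ ht₀) hR hball.1 hsupp hE
  rw [← hQ] at hflux
  obtain ⟨hdint, hdeq⟩ := integral_deficitDensity (Q := Q) hR hE hB hflux
  have hJle := norm_angularMomentum_le hc hUmeas hR hball.1 hE hB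
  rw [← hJ] at hJle
  have hpi := Real.pi_pos
  set W : ℝ := ∫ x, fieldDensity (E t₀) (B t₀) x with hW
  have hdef : ∫ x, deficitDensity (E t₀) (B t₀) x₀ R Q x ≤
      8 * Real.pi * (1 / (8 * Real.pi) * W - (c * ‖J‖ / R + Q ^ 2 / (2 * R))) := by
    have h1 : 8 * Real.pi * (1 / (8 * Real.pi) * W) = W := by field_simp
    have h2 : 8 * Real.pi * (Q ^ 2 / (2 * R)) = 4 * Real.pi * Q ^ 2 / R := by field_simp; ring
    rw [hdeq, mul_sub, mul_add, h1, h2]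
    linarith
  have hdnonneg : 0 ≤ ∫ x, deficitDensity (E t₀) (B t₀) x₀ R Q x :=
    integral_nonneg (deficitDensity_nonneg hR)
  have hW0 : 0 ≤ W := integral_nonneg (fieldDensity_nonneg _ _)
  have hineq : c * ‖J‖ / R + Q ^ 2 / (2 * R) ≤ 1 / (8 * Real.pi) * W :=
    sub_nonneg.1 (nonneg_of_mul_nonneg_right (hdnonneg.trans hdef) (by positivity))
  rw [totalEnergy_eq_ofReal hE hB, ← hW]
  refine ⟨ENNReal.ofReal_le_ofReal hineq, ?_, fun heq => ?_⟩
  · rw [← ENNReal.ofReal_pow (by positivity)]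
    refine ENNReal.ofReal_le_ofReal (le_trans ?_ (pow_le_pow_left₀ (by positivity) hineq 2))
    have hcross : 0 ≤ 2 * (c * ‖J‖ / R) * (Q ^ 2 / (2 * R)) := by positivity
    calc Q ^ 4 / (4 * R ^ 2) + c ^ 2 * ‖J‖ ^ 2 / R ^ 2
        = (c * ‖J‖ / R) ^ 2 + (Q ^ 2 / (2 * R)) ^ 2 := by ring
      _ ≤ (c * ‖J‖ / R + Q ^ 2 / (2 * R)) ^ 2 := by rw [add_sq]; linarith
  · -- equality makes the integral of the nonnegative deficit density vanish
    rw [ENNReal.ofReal_eq_ofReal_iff (by positivity) (by positivity)] at heq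
    rw [heq, sub_self, mul_zero] at hdef
    have hzero := (integral_eq_zero_iff_of_nonneg (deficitDensity_nonneg hR) hdint).1
      (le_antisymm hdef hdnonneg)
    have hshell : ∀ᵐ x : E3, E t₀ x = Q • unitShellField x₀ R x ∧ B t₀ x = 0 := by
      filter_upwards [hzero, ae_norm_sub_ne x₀ hR] with x hx hxs
      exact eq_shell_of_deficitDensity_eq_zero hR hxs hx
    refine ⟨?_, hshell.mono fun x hx => hx.2, ?_⟩
    · filter_upwards [hshell, shellField_ae_eq x₀ hR Q] with x hx hs
      rw [hx.1, hs]
    · have hcross : (fun x => cross3 (x - x₀) (cross3 (E t₀ x) (B t₀ x))) =ᵐ[volume]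
          fun _ => 0 := by
        filter_upwards [hshell] with x hx
        simp [cross3, hx.2]
      rw [hJ, angularMomentum, integral_congr_ae (ae_restrict_of_ae hcross), integral_zero,
        smul_zero]
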